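/- Let $1 \le d < D$ and let $M \subset \mathbb{R}^D$ be a compact connected $d$-dimensional embedded submanifold without boundary, of class $C^k$ for some $k \in \{1,2,\dots,\infty,\omega\}$, where $\mathbb{R}^D$ carries the Euclidean norm. For $x\in M$ let $T_xM \subset \mathbb{R}^D$ be the tangent space (a linear subspace), and let $d_M(p,q)$ be the geodesic distance on $M$, i.e. the infimum of the lengths $\int_0^1\|\gamma'(t)\|\,dt$ over the $C^1$ paths $\gamma:[0,1]\to M$ from $p$ to $q$. For a point $z$ and a set $A$ write $d(z,A)=\inf_{p\in A}\|p-z\|$. Let $$\mathrm{Med}(M)=\{z\in\mathbb{R}^D : \exists\, p\ne q\in M,\ \|p-z\|=\|q-z\|=d(z,M)\},\qquad \tau_M=\inf_{z\in \mathrm{Med}(M)} d(z,M)\in[0,\infty]$$ be the medial axis and the reach of $M$, and assume $\tau_M>0$. For $\mathbb{X}\subset M$ define $$\hat\tau(\mathbb{X})=\inf_{x\neq y\in\mathbb{X}}\frac{\|y-x\|^2}{2\,d(y-x,T_xM)}\in[0,\infty],$$ where a term with $y-x\in T_xM$ equals $\infty$, and where $1/\infty=0$. Suppose that $M$ has a bottleneck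 $(q_1,q_2)\in M^2$: there is $z_0\in\mathrm{Med}(M)$ with $\|q_1-z_0\|\le\tau_M$ and $\|q_2-z_0\|\le\tau_M$, and $\|q_1-q_2\|=2\tau_M$. Let $\mathbb{X}\subset M$ contain points $x,y$ with $\|q_1-x\|<\tau_M$ and $\|q_2-y\|<\tau_M$. Then $$0\le\frac1{\tau_M}-\frac1{\hat\tau(\mathbb{X})}\le\frac1{\tau_M}-\frac1{\hat\tau(\{x,y\})}\le\frac4{\tau_M^2}\max\{d_M(q_1,x),\,d_M(q_2,y)\}.$$ -/

import Mathlib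

open Set Metric MeasureTheory
open scoped ENNReal Manifold ContDiff

noncomputable section

namespace Reach

/-- The medial axis of a subset `A` of a Euclidean space: the points with at least two nearest
points on `A`. -/
def medialAxis {D : ℕ} (A : Set (EuclideanSpace ℝ (Fin D))) : Set (EuclideanSpace ℝ (Fin D)) :=
  {z | ∃ p ∈ A, ∃ q ∈ A, p ≠ q ∧ dist p z = infDist z A ∧ dist q z = infDist z A}

/-- The reach of `A`: the minimal distance between `A` and its medial axis
(`∞` if the medial axis is empty). -/
def reach {D : ℕ} (A : Set (EuclideanSpace ℝ (Fin D))) : ℝ≥0∞ :=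
  ⨅ z ∈ medialAxis A, infEDist z A

/-- `(q₁, q₂)` is a reach attaining pair of `M`, with axis point `z₀`. -/
def IsReachAttainingPair {D : ℕ} (M : Set (EuclideanSpace ℝ (Fin D))) (q₁ q₂ : M) : Prop :=
  q₁ ≠ q₂ ∧ ∃ z₀ ∈ medialAxis M,
    edist (q₁ : EuclideanSpace ℝ (Fin D)) z₀ ≤ reach M ∧
    edist (q₂ : EuclideanSpace ℝ (Fin D)) z₀ ≤ reach M

/-- A bottleneck: a reach attaining pair of (maximal) size `2 τ_M`. -/
def IsBottleneck {D : ℕ} (M : Set (EuclideanSpace ℝ (Fin D))) (q₁ q₂ : M) : Prop :=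
  IsReachAttainingPair M q₁ q₂ ∧ edist q₁ q₂ = 2 * reach M

/-- The geodesic distance on `M`: the infimum of the lengths `∫ ‖γ'‖` of the `C¹` paths that join
`p` to `q` inside `M` (`∞` if there is none). -/
def geodesicEDist {D : ℕ} (M : Set (EuclideanSpace ℝ (Fin D))) (p q : M) : ℝ≥0∞ :=
  ⨅ (γ : ℝ → EuclideanSpace ℝ (Fin D)) (_ : ContDiffOn ℝ 1 γ (Icc 0 1))
    (_ : MapsTo γ (Icc 0 1) M) (_ : γ 0 = p) (_ : γ 1 = q),
    ∫⁻ t in Icc (0 : ℝ) 1, ‖derivWithin γ (Icc 0 1) t‖ₑ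

/-- The tangent space `T_x M`, as a linear subspace of the ambient Euclidean space: the image of
the differential at `x` of the inclusion of `M`. -/
def tangent {D : ℕ} (d : ℕ) (M : Set (EuclideanSpace ℝ (Fin D)))
    [ChartedSpace (EuclideanSpace ℝ (Fin d)) M] (x : M) :
    Submodule ℝ (EuclideanSpace ℝ (Fin D)) :=
  LinearMap.range (mfderiv (𝓡 d) 𝓘(ℝ, EuclideanSpace ℝ (Fin D))
    (Subtype.val : M → EuclideanSpace ℝ (Fin D)) x).toLinearMap

/-- The plug-in estimator of the reach from a set `X` of points of `M`:
the infimum of `‖y - x‖² / (2 d(y - x, T_x M))` over the pairs `x ≠ y` in `X`. A pair with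
`y - x ∈ T_x M` contributes `∞`. -/
def tauHat {D : ℕ} (d : ℕ) (M : Set (EuclideanSpace ℝ (Fin D)))
    [ChartedSpace (EuclideanSpace ℝ (Fin d)) M] (X : Set M) : ℝ≥0∞ :=
  ⨅ (x ∈ X) (y ∈ X) (_ : x ≠ y),
    ‖(y : EuclideanSpace ℝ (Fin D)) - x‖ₑ ^ 2 /
      (2 * infEDist ((y : EuclideanSpace ℝ (Fin D)) - x)
        (tangent d M x : Set (EuclideanSpace ℝ (Fin D))))

/-- `1 / τ`, as an extended real number, for `τ ∈ [0, ∞]` (so `1 / ∞ = 0` and `1 / 0 = ∞`). -/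
def recip (τ : ℝ≥0∞) : EReal := ((τ⁻¹ : ℝ≥0∞) : EReal)

end Reach

end

/-!
If `A` has reach `τ`, the distance to `A` can be increased at unit speed up to `τ` by moving away
from a nearest point. So a nearest point `p` of `z` is still nearest at distance `t < τ` along the
same normal ray, and letting `t` tend to `τ` gives Federer's inequality
`2 * τ * ⟪v, y - p⟫ ≤ ‖v‖ * ‖y - p‖ ^ 2` for `v = z - p`. It extends to every `v` in the polar of
the tangent cone at a point `x`, because the nearest points of `x + s • v` are `x + o(s)`. Applied
to the component of `y - x` normal to the submanifold at `x`, it says that the plug-in estimator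
never falls below the reach.

At a point whose tangent cone is linear the opposite of a normal vector is normal, so Federer's
inequality holds with an absolute value. Along a tangent ray `x + t • v` it becomes a differential
inequality for the squared distance to `A`, and comparison with a barrier shows that
`x + t • v` lies within `t ^ 2 / τ` of `A`.

At a bottleneck `(q₁, q₂)` the axis point `z` is the midpoint, and the open ball of radius `τ`
around it does not meet the submanifold. By the contact estimate, a tangent space at a point `x`
near `q₁` that leaned towards `z` would force a point of the submanifold into this ball. Hence
`y - x` is almost normal at `x` when `y` is near `q₂`, with length close to `2 * τ`, and the
quotient of the pair `(x, y)` is close to `τ`.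
-/

namespace Reach

open Filter Topology
open scoped RealInnerProductSpace

section NearestPoint

section Metric

variable {X : Type*} [PseudoMetricSpace X] {A : Set X}

/-- `p` is a nearest point of `A` to `w`, i.e. a metric projection of `w` to `A`. -/
def IsNearestPt (A : Set X) (w p : X) : Prop :=
  p ∈ A ∧ dist w p = infDist w A

/-- `A` has reach at least `τ`: a point at distance less than `τ` from `A` has at most one nearest
point on `A`. -/
def HasReachAtLeast (A : Set X) (τ : ℝ) : Prop :=
  ∀ ⦃w⦄, infDist w A < τ → ∀ ⦃p q⦄, IsNearestPt A w p → IsNearestPt A w q → p = q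

theorem IsNearestPt.dist_le {w p y : X} (hp : IsNearestPt A w p) (hy : y ∈ A) :
    dist w p ≤ dist w y :=
  hp.2.trans_le (infDist_le_dist_of_mem hy)

theorem isNearestPt_of_dist_le_infDist {w p : X} (hp : p ∈ A) (h : dist w p ≤ infDist w A) :
    IsNearestPt A w p :=
  ⟨hp, h.antisymm (infDist_le_dist_of_mem hp)⟩

variable [ProperSpace X]

theorem exists_isNearestPt (hA : IsClosed A) (hA₀ : A.Nonempty) (w : X) :
    ∃ p, IsNearestPt A w p :=
  let ⟨p, hp, h⟩ := hA.exists_infDist_eq_dist hA₀ w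
  ⟨p, hp, h.symm⟩

theorem tendsto_isNearestPt {ι : Type*} {l : Filter ι} {w p : ι → X} {w₀ p₀ : X}
    (hA : IsClosed A) (hw : Tendsto w l (𝓝 w₀)) (hp : ∀ i, IsNearestPt A (w i) (p i))
    (huniq : ∀ q, IsNearestPt A w₀ q → q = p₀) : Tendsto p l (𝓝 p₀) := by
  have hdist : Tendsto (fun i ↦ dist (w i) w₀ + dist (w i) (p i)) l (𝓝 (0 + infDist w₀ A)) := by
    simp only [(hp _).2]
    exact (tendsto_iff_dist_tendsto_zero.1 hw).add ((continuous_infDist_pt A).tendsto w₀ |>.comp hw)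
  have hball : ∀ᶠ i in l, p i ∈ closedBall w₀ (infDist w₀ A + 1) := by
    filter_upwards [hdist.eventually_le_const (u := infDist w₀ A + 1) (by linarith)] with i hi
    rw [mem_closedBall, dist_comm]
    exact (dist_triangle_left _ _ _).trans hi
  refine (isCompact_closedBall _ _).tendsto_nhds_of_unique_mapClusterPt hball fun q _ hq ↦ ?_
  obtain ⟨U, hU, hpq⟩ := mapClusterPt_iff_ultrafilter.1 hq
  have hwU : Tendsto w U (𝓝 w₀) := hw.mono_left hU
  refine huniq q ⟨hA.mem_of_tendsto hpq (Eventually.of_forall fun i ↦ (hp i).1), ?_⟩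
  refine tendsto_nhds_unique (hwU.dist hpq) ?_
  simp only [(hp _).2]
  exact (continuous_infDist_pt A).tendsto w₀ |>.comp hwU

end Metric

variable {E : Type*} [NormedAddCommGroup E] [InnerProductSpace ℝ E] {A : Set E}

theorem IsNearestPt.two_mul_inner_le {w p y : E} (hp : IsNearestPt A w p) (hy : y ∈ A) :
    2 * ⟪w - p, y - p⟫ ≤ ‖y - p‖ ^ 2 := by
  have hle : ‖w - p‖ ^ 2 ≤ ‖(w - p) - (y - p)‖ ^ 2 := by
    rw [sub_sub_sub_cancel_right, ← dist_eq_norm, ← dist_eq_norm]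
    exact pow_le_pow_left₀ dist_nonneg (hp.dist_le hy) 2
  rw [norm_sub_sq_real (w - p)] at hle
  linarith

theorem IsNearestPt.norm_sub_sq_le {w p x : E} (hp : IsNearestPt A w p) (hx : x ∈ A) :
    ‖p - x‖ ^ 2 ≤ 2 * ⟪w - x, p - x⟫ := by
  have hle : ‖(w - x) - (p - x)‖ ^ 2 ≤ ‖w - x‖ ^ 2 := by
    rw [sub_sub_sub_cancel_right, ← dist_eq_norm, ← dist_eq_norm]
    exact pow_le_pow_left₀ dist_nonneg (hp.dist_le hx) 2
  rw [norm_sub_sq_real (w - x)] at hle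
  linarith

variable [ProperSpace E]

theorem eventually_infDist_add_mul_le (hA : IsClosed A) {w p v : E} {c : ℝ}
    (hp : IsNearestPt A w p) (huniq : ∀ q, IsNearestPt A w q → q = p)
    (hc : c * ‖w - p‖ < ⟪w - p, v⟫) :
    ∀ᶠ t in 𝓝[>] (0 : ℝ), infDist w A + c * t ≤ infDist (w + t • v) A := by
  choose q hq using fun t : ℝ ↦ exists_isNearestPt hA ⟨p, hp.1⟩ (w + t • v)
  have hlim : Tendsto q (𝓝[>] 0) (𝓝 p) := by
    refine tendsto_isNearestPt hA (w₀ := w) ?_ hq huniq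
    have : Tendsto (fun t : ℝ ↦ w + t • v) (𝓝 0) (𝓝 (w + (0 : ℝ) • v)) :=
      Continuous.tendsto (by fun_prop) 0
    simpa using this.mono_left nhdsWithin_le_nhds
  have hwp : w - p ≠ 0 := by
    intro h
    simp [h] at hc
  have hsub : Tendsto (fun t ↦ w - q t) (𝓝[>] 0) (𝓝 (w - p)) := tendsto_const_nhds.sub hlim
  filter_upwards [(hsub.norm.const_mul c).eventually_lt (hsub.inner tendsto_const_nhds) hc,
    hsub.eventually_ne hwp, self_mem_nhdsWithin] with t ht hne (ht₀ : 0 < t)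
  have hcs : ‖w - q t‖ ^ 2 + t * ⟪w - q t, v⟫ ≤ ‖w - q t‖ * ‖w + t • v - q t‖ := by
    refine le_of_eq_of_le ?_ (real_inner_le_norm _ _)
    rw [add_sub_right_comm, inner_add_right, real_inner_self_eq_norm_sq, real_inner_smul_right]
  rw [← (hq t).2, dist_eq_norm]
  have hle : ‖w - q t‖ + c * t ≤ ‖w + t • v - q t‖ := by
    refine le_of_mul_le_mul_left ?_ (norm_pos_iff.2 hne)
    nlinarith
  have := infDist_le_dist_of_mem (x := w) (hq t).1
  rw [dist_eq_norm] at this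
  linarith

theorem exists_infDist_add_mul_le (hA : IsClosed A) (hA₀ : A.Nonempty) {τ : ℝ}
    (hτ : HasReachAtLeast A τ) {z : E} (hz : 0 < infDist z A) {h : ℝ} (hh : 0 ≤ h)
    (hzh : infDist z A + h < τ) {c : ℝ} (hc₀ : 0 ≤ c) (hc : c < 1) :
    ∃ w ∈ closedBall z h, infDist z A + c * h ≤ infDist w A := by
  have hzmem : z ∈ closedBall z h := mem_closedBall_self hh
  -- A maximizer in the interior of the ball could be moved away from its nearest point.
  obtain ⟨w, hw, hmax⟩ := (isCompact_closedBall z h).exists_isMaxOn ⟨z, hzmem⟩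
    (f := fun w ↦ infDist w A - c * dist w z)
    ((continuous_infDist_pt A).sub (by fun_prop)).continuousOn
  have hzw : infDist z A ≤ infDist w A - c * dist w z := by simpa using hmax hzmem
  refine ⟨w, hw, ?_⟩
  rcases (mem_closedBall.1 hw).eq_or_lt with hwz | hwz
  · rw [← hwz]
    linarith
  exfalso
  obtain ⟨p, hp⟩ := exists_isNearestPt hA hA₀ w
  have hwpos : 0 < ‖w - p‖ := by
    rw [← dist_eq_norm, hp.2]
    nlinarith [dist_nonneg (x := w) (y := z)]
  have hwτ : infDist w A < τ := by
    have := infDist_le_infDist_add_dist (s := A) (x := w) (y := z)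
    linarith
  have hgrow := eventually_infDist_add_mul_le hA (v := w - p) (c := (1 + c) / 2 * ‖w - p‖) hp
    (fun q hq ↦ hτ hwτ hq hp) (by
      rw [real_inner_self_eq_norm_sq]
      nlinarith [mul_pos hwpos hwpos])
  obtain ⟨t, ht, ht₀, ht₁⟩ :=
    (hgrow.and (Ioo_mem_nhdsGT (div_pos (sub_pos.2 hwz) hwpos))).exists
  rw [lt_div_iff₀ hwpos] at ht₁
  have hdist : dist (w + t • (w - p)) z ≤ t * ‖w - p‖ + dist w z := by
    refine (dist_triangle _ w _).trans_eq ?_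
    rw [dist_eq_norm, add_sub_cancel_left, norm_smul, Real.norm_of_nonneg ht₀.le]
  have hmem : w + t • (w - p) ∈ closedBall z h := mem_closedBall.2 (by linarith)
  have hle : infDist (w + t • (w - p)) A - c * dist (w + t • (w - p)) z ≤
      infDist w A - c * dist w z := hmax hmem
  nlinarith [mul_le_mul_of_nonneg_left hdist hc₀, mul_pos ht₀ hwpos]

theorem exists_infDist_add_le (hA : IsClosed A) (hA₀ : A.Nonempty) {τ : ℝ}
    (hτ : HasReachAtLeast A τ) {z : E} (hz : 0 < infDist z A) {h : ℝ} (hh : 0 ≤ h)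
    (hzh : infDist z A + h < τ) : ∃ w ∈ closedBall z h, infDist z A + h ≤ infDist w A := by
  obtain ⟨w, hw, hmax⟩ := (isCompact_closedBall z h).exists_isMaxOn ⟨z, mem_closedBall_self hh⟩
    (continuous_infDist_pt A).continuousOn
  refine ⟨w, hw, ?_⟩
  have hlim : Tendsto (fun c : ℝ ↦ infDist z A + c * h) (𝓝[<] 1) (𝓝 (infDist z A + 1 * h)) :=
    (Continuous.tendsto (by fun_prop) _).mono_left nhdsWithin_le_nhds
  rw [one_mul] at hlim
  refine le_of_tendsto hlim ?_
  filter_upwards [Ioo_mem_nhdsLT (zero_lt_one' ℝ)] with c ⟨hc₀, hc⟩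
  obtain ⟨w', hw', hle⟩ := exists_infDist_add_mul_le hA hA₀ hτ hz hh hzh hc₀.le hc
  exact hle.trans (hmax hw')

theorem IsNearestPt.add_smul_sub (hA : IsClosed A) {τ : ℝ} (hτ : HasReachAtLeast A τ) {z p : E}
    (hp : IsNearestPt A z p) (hz : 0 < infDist z A) {a : ℝ} (ha : 1 ≤ a)
    (haτ : a * infDist z A < τ) : IsNearestPt A (p + a • (z - p)) p := by
  have hzp : ‖z - p‖ = infDist z A := by rw [← dist_eq_norm, hp.2]
  obtain ⟨w, hw, hle⟩ := exists_infDist_add_le hA ⟨p, hp.1⟩ hτ hz (h := (a - 1) * infDist z A)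
    (mul_nonneg (sub_nonneg.2 ha) hz.le) (by linarith)
  have hle' : a * infDist z A ≤ infDist w A := by linarith
  rw [mem_closedBall, dist_eq_norm] at hw
  have hwp : infDist w A ≤ ‖w - p‖ := by
    rw [← dist_eq_norm]
    exact infDist_le_dist_of_mem hp.1
  have htri : ‖w - p‖ ≤ ‖w - z‖ + ‖z - p‖ := norm_sub_le_norm_sub_add_norm_sub w z p
  have hray : SameRay ℝ (w - z) (z - p) := by
    rw [sameRay_iff_norm_add, sub_add_sub_cancel]
    linarith
  have hwz : w - z = (a - 1) • (z - p) := by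
    rw [sameRay_iff_norm_smul_eq, hzp, show ‖w - z‖ = (a - 1) * infDist z A by linarith,
      mul_comm, mul_smul] at hray
    exact (smul_right_injective E hz.ne' hray).symm
  have hw_eq : w = p + a • (z - p) := by
    rw [← sub_add_cancel w z, hwz, sub_smul, one_smul]
    abel
  refine isNearestPt_of_dist_le_infDist hp.1 ?_
  rw [← hw_eq, dist_eq_norm]
  linarith

theorem IsNearestPt.two_mul_mul_inner_le (hA : IsClosed A) {τ : ℝ} (hτ : HasReachAtLeast A τ)
    {z p y : E} (hp : IsNearestPt A z p) (hzτ : infDist z A < τ) (hy : y ∈ A) :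
    2 * τ * ⟪z - p, y - p⟫ ≤ ‖z - p‖ * ‖y - p‖ ^ 2 := by
  have hzp : ‖z - p‖ = infDist z A := by rw [← dist_eq_norm, hp.2]
  rcases (infDist_nonneg (x := z) (s := A)).eq_or_lt with hz | hz
  · rw [norm_eq_zero.1 (hzp.trans hz.symm)]
    simp
  have hpush : ∀ t ∈ Ioo (infDist z A) τ, 2 * t * ⟪z - p, y - p⟫ ≤ ‖z - p‖ * ‖y - p‖ ^ 2 := by
    intro t ht
    have hle := (hp.add_smul_sub hA hτ hz (a := t / infDist z A) ((one_le_div hz).2 ht.1.le)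
      (by rw [div_mul_cancel₀ _ hz.ne']; exact ht.2)).two_mul_inner_le hy
    rw [add_sub_cancel_left, real_inner_smul_left] at hle
    calc 2 * t * ⟪z - p, y - p⟫
        = infDist z A * (2 * (t / infDist z A * ⟪z - p, y - p⟫)) := by field_simp
      _ ≤ infDist z A * ‖y - p‖ ^ 2 := mul_le_mul_of_nonneg_left hle hz.le
      _ = ‖z - p‖ * ‖y - p‖ ^ 2 := by rw [hzp]
  have hlim : Tendsto (fun t : ℝ ↦ 2 * t * ⟪z - p, y - p⟫) (𝓝[<] τ)
      (𝓝 (2 * τ * ⟪z - p, y - p⟫)) :=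
    (Continuous.tendsto (by fun_prop) _).mono_left nhdsWithin_le_nhds
  exact le_of_tendsto hlim (mem_of_superset (Ioo_mem_nhdsLT hzτ) hpush)

end NearestPoint

theorem mem_posTangentConeAt_of_tendsto {E : Type*} [NormedAddCommGroup E] [NormedSpace ℝ E]
    {A : Set E} {l : Filter ℝ} [l.NeBot] (hl : l ≤ 𝓝[>] 0) {x u : E} {p : ℝ → E}
    (hp : ∀ᶠ s in l, p s ∈ A) (hu : Tendsto (fun s ↦ s⁻¹ • (p s - x)) l (𝓝 u)) :
    u ∈ posTangentConeAt A x := by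
  have hpos : ∀ᶠ s in l, 0 < s := hl self_mem_nhdsWithin
  have hs₀ : Tendsto (fun s : ℝ ↦ s) l (𝓝 0) := hl.trans nhdsWithin_le_nhds
  have hzero : Tendsto (fun s ↦ p s - x) l (𝓝 0) :=
    (zero_smul ℝ u ▸ hs₀.smul hu).congr' (hpos.mono fun s hs ↦ smul_inv_smul₀ hs.ne' _)
  refine mem_tangentConeAt_of_seq l (fun s ↦ s⁻¹.toNNReal) _ hzero
    (hp.mono fun s hs ↦ by rwa [add_sub_cancel]) (hu.congr' (hpos.mono fun s hs ↦ ?_))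
  simp only [NNReal.smul_def, Real.coe_toNNReal _ (inv_nonneg.2 hs.le)]

section NormalCone

variable {E : Type*} [NormedAddCommGroup E] [InnerProductSpace ℝ E] {A : Set E}

/-- Federer's normal cone `Nor(A, x)`: the polar cone of the tangent cone of `A` at `x`. -/
def normalCone (A : Set E) (x : E) : Set E :=
  {v | ∀ u ∈ posTangentConeAt A x, ⟪v, u⟫ ≤ 0}

theorem IsNearestPt.sub_mem_normalCone {w p : E} (hp : IsNearestPt A w p) :
    w - p ∈ normalCone A p := by
  intro u hu
  have hderiv : HasFDerivWithinAt (fun y ↦ ‖y - w‖ ^ 2) (2 • innerSL ℝ (p - w)) A p :=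
    ((hasFDerivWithinAt_id p A).sub_const w).norm_sq
  have hmin : IsMinOn (fun y ↦ ‖y - w‖ ^ 2) A p := by
    intro y hy
    simpa only [mem_ofPred_eq, ← dist_eq_norm', pow_two] using
      mul_self_le_mul_self dist_nonneg (hp.dist_le hy)
  have hnonneg := hmin.localize.hasFDerivWithinAt_nonneg hderiv hu
  simp only [smul_apply, innerSL_apply_apply, nsmul_eq_mul] at hnonneg
  rw [← neg_sub p w, inner_neg_left]
  push_cast at hnonneg
  linarith

theorem tendsto_inv_smul_sub_of_mem_normalCone [ProperSpace E] {x v : E} (hv : v ∈ normalCone A x)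
    (hx : x ∈ A) {p : ℝ → E} (hp : ∀ s, IsNearestPt A (x + s • v) (p s)) :
    Tendsto (fun s ↦ s⁻¹ • (p s - x)) (𝓝[>] 0) (𝓝 0) := by
  have hsq : ∀ᶠ s in 𝓝[>] (0 : ℝ), ‖s⁻¹ • (p s - x)‖ ^ 2 ≤ 2 * ⟪v, s⁻¹ • (p s - x)⟫ := by
    filter_upwards [self_mem_nhdsWithin] with s (hs : 0 < s)
    have hle := (hp s).norm_sub_sq_le hx
    rw [add_sub_cancel_left, real_inner_smul_left] at hle
    rw [norm_smul, mul_pow, Real.norm_of_nonneg (inv_nonneg.2 hs.le), real_inner_smul_right]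
    calc s⁻¹ ^ 2 * ‖p s - x‖ ^ 2 ≤ s⁻¹ ^ 2 * (2 * (s * ⟪v, p s - x⟫)) := by gcongr
      _ = 2 * (s⁻¹ * ⟪v, p s - x⟫) := by field_simp
  have hball : ∀ᶠ s in 𝓝[>] (0 : ℝ), s⁻¹ • (p s - x) ∈ closedBall 0 (2 * ‖v‖) := by
    filter_upwards [hsq] with s hs
    rw [mem_closedBall_zero_iff]
    have := real_inner_le_norm v (s⁻¹ • (p s - x))
    by_contra! hlt
    nlinarith [norm_nonneg v]
  refine (isCompact_closedBall _ _).tendsto_nhds_of_unique_mapClusterPt hball fun u _ hu ↦ ?_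
  obtain ⟨U, hU, hlim⟩ := mapClusterPt_iff_ultrafilter.1 hu
  have hcone : u ∈ posTangentConeAt A x :=
    mem_posTangentConeAt_of_tendsto hU (Eventually.of_forall fun s ↦ (hp s).1) hlim
  have hlim_sq : ‖u‖ ^ 2 ≤ 2 * ⟪v, u⟫ :=
    le_of_tendsto_of_tendsto (hlim.norm.pow 2) ((tendsto_const_nhds.inner hlim).const_mul 2)
      (hU hsq)
  have hvu : ⟪v, u⟫ ≤ 0 := hv u hcone
  exact norm_eq_zero.1 (pow_eq_zero_iff two_ne_zero |>.1 (by nlinarith [sq_nonneg ‖u‖]))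

theorem two_mul_mul_inner_le_of_mem_normalCone [ProperSpace E] (hA : IsClosed A) {τ : ℝ}
    (hτ₀ : 0 < τ) (hτ : HasReachAtLeast A τ) {x y v : E} (hx : x ∈ A) (hy : y ∈ A)
    (hv : v ∈ normalCone A x) : 2 * τ * ⟪v, y - x⟫ ≤ ‖v‖ * ‖y - x‖ ^ 2 := by
  choose p hp using fun s : ℝ ↦ exists_isNearestPt hA ⟨x, hx⟩ (x + s • v)
  set ρ : ℝ → E := fun s ↦ s⁻¹ • (p s - x)
  have hρ : Tendsto ρ (𝓝[>] 0) (𝓝 0) := tendsto_inv_smul_sub_of_mem_normalCone hv hx hp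
  have hs₀ : Tendsto (fun s : ℝ ↦ s) (𝓝[>] 0) (𝓝 0) := nhdsWithin_le_nhds
  have hvρ : Tendsto (fun s ↦ v - ρ s) (𝓝[>] 0) (𝓝 v) := by
    simpa using tendsto_const_nhds.sub hρ
  have hyρ : Tendsto (fun s ↦ y - x - s • ρ s) (𝓝[>] 0) (𝓝 (y - x)) := by
    simpa using tendsto_const_nhds.sub (hs₀.smul hρ)
  refine le_of_tendsto_of_tendsto ((hvρ.inner hyρ).const_mul (2 * τ))
    (hvρ.norm.mul (hyρ.norm.pow 2)) ?_
  have hsmall : ∀ᶠ s in 𝓝[>] (0 : ℝ), s * ‖v‖ < τ :=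
    (hs₀.mul_const ‖v‖).eventually_lt_const (by simpa using hτ₀)
  filter_upwards [hsmall, self_mem_nhdsWithin] with s hsτ (hs : 0 < s)
  have hdist : infDist (x + s • v) A < τ := by
    refine (infDist_le_dist_of_mem hx).trans_lt ?_
    rwa [dist_eq_norm, add_sub_cancel_left, norm_smul, Real.norm_of_nonneg hs.le]
  have hsρ : s • ρ s = p s - x := smul_inv_smul₀ hs.ne' _
  have hv_eq : x + s • v - p s = s • (v - ρ s) := by
    rw [smul_sub, hsρ]
    abel
  have hy_eq : y - p s = y - x - s • ρ s := by
    rw [hsρ]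
    abel
  have hfed := (hp s).two_mul_mul_inner_le hA hτ hdist hy
  rw [hv_eq, hy_eq, real_inner_smul_left, norm_smul, Real.norm_of_nonneg hs.le] at hfed
  refine le_of_mul_le_mul_left ?_ hs
  linarith

theorem frequently_infDist_add_smul_le {x v : E} (hv : v ∈ posTangentConeAt A x) (hv₁ : ‖v‖ = 1)
    {η : ℝ} (hη : 0 < η) : ∃ᶠ a in 𝓝[>] (0 : ℝ), infDist (x + a • v) A ≤ η * a := by
  obtain ⟨ι, l, _, c, e, he₀, heA, hce⟩ := exists_fun_of_mem_tangentConeAt hv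
  have hne : ∀ᶠ i in l, c i • e i ≠ 0 := hce.eventually_ne (by rintro rfl; simp at hv₁)
  have hnorm : Tendsto (fun i ↦ ‖e i‖) l (𝓝[>] 0) :=
    tendsto_nhdsWithin_iff.2 ⟨by simpa using he₀.norm,
      hne.mono fun i hi ↦ norm_pos_iff.2 (right_ne_zero_of_smul hi)⟩
  have hdir : Tendsto (fun i ↦ ‖e i‖⁻¹ • e i) l (𝓝 v) := by
    have hlim := (hce.norm.inv₀ (by simp [hv₁])).smul hce
    rw [hv₁, inv_one, one_smul] at hlim
    refine hlim.congr' (hne.mono fun i hi ↦ ?_)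
    have hc : (c i : ℝ) ≠ 0 := by simpa using left_ne_zero_of_smul hi
    rw [NNReal.smul_def, norm_smul, Real.norm_of_nonneg (NNReal.coe_nonneg _), smul_smul, mul_inv,
      mul_right_comm, inv_mul_cancel₀ hc, one_mul]
  refine hnorm.frequently (Eventually.frequently ?_)
  filter_upwards [hdir.eventually_mem (closedBall_mem_nhds v hη), heA, hne] with i hi hiA hei
  have he : ‖e i‖ ≠ 0 := norm_ne_zero_iff.2 (right_ne_zero_of_smul hei)
  calc infDist (x + ‖e i‖ • v) A ≤ dist (x + ‖e i‖ • v) (x + e i) := infDist_le_dist_of_mem hiA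
    _ = dist (‖e i‖ • (‖e i‖⁻¹ • e i)) (‖e i‖ • v) := by
      rw [dist_add_left, smul_inv_smul₀ he, dist_comm]
    _ = dist (‖e i‖⁻¹ • e i) v * ‖e i‖ := by rw [dist_smul₀, norm_norm, mul_comm]
    _ ≤ η * ‖e i‖ := by gcongr; exact hi

end NormalCone

section TangentDirection

variable {E : Type*} [NormedAddCommGroup E] [InnerProductSpace ℝ E] {A : Set E}

/-- The tangent cone of `A` at each of its points is a linear subspace, as for a submanifold. -/
def HasLinearTangentCones (A : Set E) : Prop :=
  ∀ p ∈ A, ∃ S : Submodule ℝ E, posTangentConeAt A p = S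

theorem HasLinearTangentCones.neg_mem_normalCone (hlin : HasLinearTangentCones A) {p v : E}
    (hp : p ∈ A) (hv : v ∈ normalCone A p) : -v ∈ normalCone A p := by
  obtain ⟨S, hS⟩ := hlin p hp
  intro u hu
  have hneg : -u ∈ posTangentConeAt A p := by
    rw [hS, SetLike.mem_coe] at hu ⊢
    exact S.neg_mem hu
  simpa [inner_neg_left, inner_neg_right] using hv (-u) hneg

theorem eventually_slope_sq_infDist_lt {x v p : E} {t r : ℝ}
    (hp : IsNearestPt A (x + t • v) p) (hr : 2 * ⟪x + t • v - p, v⟫ < r) :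
    ∀ᶠ z in 𝓝[>] t, slope (fun s ↦ infDist (x + s • v) A ^ 2) t z < r := by
  have hlim : Tendsto (fun z ↦ 2 * ⟪x + t • v - p, v⟫ + (z - t) * ‖v‖ ^ 2) (𝓝[>] t)
      (𝓝 (2 * ⟪x + t • v - p, v⟫ + (t - t) * ‖v‖ ^ 2)) :=
    (Continuous.tendsto (by fun_prop) t).mono_left nhdsWithin_le_nhds
  rw [sub_self, zero_mul, add_zero] at hlim
  filter_upwards [hlim.eventually_lt_const hr, self_mem_nhdsWithin] with z hz (htz : t < z)
  refine lt_of_le_of_lt ?_ hz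
  have hsub : x + z • v - p = (x + t • v - p) + (z - t) • v := by
    rw [sub_smul]
    abel
  have hle : infDist (x + z • v) A ^ 2 ≤ ‖x + z • v - p‖ ^ 2 := by
    rw [← dist_eq_norm]
    exact pow_le_pow_left₀ infDist_nonneg (infDist_le_dist_of_mem hp.1) 2
  rw [hsub, norm_add_sq_real, real_inner_smul_right, norm_smul, mul_pow,
    Real.norm_eq_abs, sq_abs] at hle
  rw [slope_def_field, div_le_iff₀ (sub_pos.2 htz), ← hp.2, dist_eq_norm]
  linarith

variable [ProperSpace E]

theorem two_mul_abs_inner_le_of_isNearestPt (hA : IsClosed A) {τ : ℝ}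
    (hτ₀ : 0 < τ) (hτ : HasReachAtLeast A τ) (hlin : HasLinearTangentCones A) {w p y : E}
    (hp : IsNearestPt A w p) (hy : y ∈ A) :
    2 * τ * |⟪w - p, y - p⟫| ≤ ‖w - p‖ * ‖y - p‖ ^ 2 := by
  have hpos := two_mul_mul_inner_le_of_mem_normalCone hA hτ₀ hτ hp.1 hy hp.sub_mem_normalCone
  have hneg := two_mul_mul_inner_le_of_mem_normalCone hA hτ₀ hτ hp.1 hy
    (hlin.neg_mem_normalCone hp.1 hp.sub_mem_normalCone)
  rw [inner_neg_left, norm_neg] at hneg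
  rcases abs_choice ⟪w - p, y - p⟫ with h | h <;> rw [h] <;> assumption

theorem mul_inner_sub_le_of_isNearestPt (hA : IsClosed A) {τ : ℝ} (hτ₀ : 0 < τ)
    (hτ : HasReachAtLeast A τ) (hlin : HasLinearTangentCones A) {x v p : E} {t : ℝ} (ht : 0 ≤ t)
    (hx : x ∈ A) (hv : ‖v‖ = 1) (hp : IsNearestPt A (x + t • v) p) :
    2 * τ * (t * ⟪x + t • v - p, v⟫) ≤ 2 * τ * infDist (x + t • v) A ^ 2 +
      infDist (x + t • v) A * (t + infDist (x + t • v) A) ^ 2 := by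
  set n := x + t • v - p with hn
  have hnorm : ‖n‖ = infDist (x + t • v) A := by rw [hn, ← dist_eq_norm, hp.2]
  have hx_eq : x - p = n - t • v := by
    rw [hn]
    abel
  have hfed := two_mul_abs_inner_le_of_isNearestPt hA hτ₀ hτ hlin hp hx
  rw [← hn, hx_eq, inner_sub_right, real_inner_self_eq_norm_sq, real_inner_smul_right, hnorm]
    at hfed
  have htri : ‖n - t • v‖ ≤ t + infDist (x + t • v) A := by
    refine (norm_sub_le _ _).trans_eq ?_
    rw [norm_smul, hv, Real.norm_of_nonneg ht, hnorm, mul_one, add_comm]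
  have hsq : infDist (x + t • v) A * ‖n - t • v‖ ^ 2 ≤
      infDist (x + t • v) A * (t + infDist (x + t • v) A) ^ 2 :=
    mul_le_mul_of_nonneg_left (pow_le_pow_left₀ (norm_nonneg _) htri 2) infDist_nonneg
  have := mul_le_mul_of_nonneg_left
    (neg_abs_le (infDist (x + t • v) A ^ 2 - t * ⟪n, v⟫)) (mul_nonneg zero_le_two hτ₀.le)
  linarith

/-- The barrier `t² / τ + η t` is a strict supersolution of the differential inequality for the
distance from `x + t v` to `A` as long as `1 + t / τ + η < √2`. -/
theorem two_mul_inner_sub_lt_of_infDist_eq (hA : IsClosed A) {τ : ℝ} (hτ₀ : 0 < τ)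
    (hτ : HasReachAtLeast A τ) (hlin : HasLinearTangentCones A) {x v p : E} (hx : x ∈ A)
    (hv₁ : ‖v‖ = 1) {η t : ℝ} (hη₀ : 0 < η) (hη : η ≤ 1 / 100) (ht₀ : 0 < t)
    (htL : t ≤ 2 / 5 * τ) (hp : IsNearestPt A (x + t • v) p)
    (hD : infDist (x + t • v) A = t ^ 2 / τ + η * t) :
    2 * ⟪x + t • v - p, v⟫ < 2 * (t ^ 2 / τ + η * t) * (2 * t / τ + η) := by
  have hfed := mul_inner_sub_le_of_isNearestPt hA hτ₀ hτ hlin ht₀.le hx hv₁ hp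
  rw [hD] at hfed
  have hb : t ^ 2 / τ + η * t ≤ 41 / 100 * t := by
    have : t ^ 2 / τ ≤ 2 / 5 * t := by
      rw [div_le_iff₀ hτ₀]
      nlinarith
    nlinarith
  have hbτ : τ * (t ^ 2 / τ + η * t) = t ^ 2 + η * τ * t := by field_simp
  have hbar_pos : 0 < t ^ 2 / τ + η * t := by positivity
  set b := t ^ 2 / τ + η * t
  have hsq : (t + b) ^ 2 < 2 * t ^ 2 := by nlinarith
  have hscaled : 2 * τ * (t * ⟪x + t • v - p, v⟫) < 2 * b * (2 * t ^ 2 + η * τ * t) := by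
    calc _ ≤ 2 * b * (τ * b) + b * (t + b) ^ 2 := by linarith
      _ < 2 * b * (τ * b) + b * (2 * t ^ 2) := by gcongr
      _ = _ := by rw [hbτ]; ring
  have hdiv : 2 * t / τ + η = (2 * t ^ 2 + η * τ * t) / (τ * t) := by field_simp
  rw [hdiv, ← mul_div_assoc, lt_div_iff₀ (mul_pos hτ₀ ht₀)]
  linarith

theorem infDist_add_smul_le_add (hA : IsClosed A) {τ : ℝ} (hτ₀ : 0 < τ)
    (hτ : HasReachAtLeast A τ) (hlin : HasLinearTangentCones A) {x v : E} (hx : x ∈ A)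
    (hv : v ∈ posTangentConeAt A x) (hv₁ : ‖v‖ = 1) {η : ℝ} (hη₀ : 0 < η) (hη : η ≤ 1 / 100)
    {L : ℝ} (hL₀ : 0 < L) (hL : L ≤ 2 / 5 * τ) : infDist (x + L • v) A ≤ L ^ 2 / τ + η * L := by
  obtain ⟨a, ha, ha₀, haL⟩ :=
    ((frequently_infDist_add_smul_le hv hv₁ hη₀).and_eventually (Ioo_mem_nhdsGT hL₀)).exists
  choose p hp using fun t : ℝ ↦ exists_isNearestPt hA ⟨x, hx⟩ (x + t • v)
  have hbar₀ : ∀ t, 0 ≤ t → 0 ≤ t ^ 2 / τ + η * t := fun t ht ↦ by positivity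
  suffices hsq : infDist (x + L • v) A ^ 2 ≤ (L ^ 2 / τ + η * L) ^ 2 from
    le_of_sq_le_sq hsq (hbar₀ L hL₀.le)
  refine image_le_of_liminf_slope_right_lt_deriv_boundary (a := a) (b := L)
    (f := fun t ↦ infDist (x + t • v) A ^ 2) (f' := fun t ↦ 2 * ⟪x + t • v - p t, v⟫)
    (B := fun t ↦ (t ^ 2 / τ + η * t) ^ 2)
    (B' := fun t ↦ 2 * (t ^ 2 / τ + η * t) * (2 * t / τ + η)) ?_ ?_ ?_ ?_ ?_ ⟨haL.le, le_rfl⟩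
  · exact (((continuous_infDist_pt A).comp (by fun_prop)).pow 2).continuousOn
  · exact fun t _ r hr ↦ (eventually_slope_sq_infDist_lt (hp t) hr).frequently
  · refine pow_le_pow_left₀ infDist_nonneg (ha.trans ?_) 2
    have : 0 ≤ a ^ 2 / τ := by positivity
    linarith
  · intro t
    have hlin_deriv : HasDerivAt (fun s : ℝ ↦ s ^ 2 / τ + η * s) (2 * t / τ + η) t := by
      simpa using ((hasDerivAt_pow 2 t).div_const τ).fun_add ((hasDerivAt_id' t).const_mul η)
    simpa using hlin_deriv.fun_pow 2
  · rintro t ⟨hat, htL⟩ hcontact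
    have ht₀ : 0 < t := ha₀.trans_le hat
    have hD : infDist (x + t • v) A = t ^ 2 / τ + η * t :=
      (sq_eq_sq₀ infDist_nonneg (hbar₀ t ht₀.le)).1 hcontact
    exact two_mul_inner_sub_lt_of_infDist_eq hA hτ₀ hτ hlin hx hv₁ hη₀ hη ht₀ (htL.le.trans hL)
      (hp t) hD

theorem infDist_add_smul_le (hA : IsClosed A) {τ : ℝ} (hτ₀ : 0 < τ) (hτ : HasReachAtLeast A τ)
    (hlin : HasLinearTangentCones A) {x v : E} (hx : x ∈ A) (hv : v ∈ posTangentConeAt A x)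
    (hv₁ : ‖v‖ = 1) {L : ℝ} (hL₀ : 0 < L) (hL : L ≤ 2 / 5 * τ) :
    infDist (x + L • v) A ≤ L ^ 2 / τ := by
  have hlim : Tendsto (fun η : ℝ ↦ L ^ 2 / τ + η * L) (𝓝[>] 0) (𝓝 (L ^ 2 / τ + 0 * L)) :=
    (Continuous.tendsto (by fun_prop) _).mono_left nhdsWithin_le_nhds
  rw [zero_mul, add_zero] at hlim
  refine ge_of_tendsto hlim ?_
  filter_upwards [Ioo_mem_nhdsGT (show (0 : ℝ) < 1 / 100 by norm_num)] with η ⟨hη₀, hη⟩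
  exact infDist_add_smul_le_add hA hτ₀ hτ hlin hx hv hv₁ hη₀ hη.le hL₀ hL

end TangentDirection

section Bottleneck

variable {E : Type*} [NormedAddCommGroup E] [InnerProductSpace ℝ E] {A : Set E}

theorem norm_sub_sq_le_of_isNearestPt [ProperSpace E] (hA : IsClosed A) {τ : ℝ} (hτ₀ : 0 < τ)
    (hτ : HasReachAtLeast A τ) (hlin : HasLinearTangentCones A) {z q x : E}
    (hq : IsNearestPt A z q) (hzq : ‖z - q‖ = τ) (hx : x ∈ A) :
    ‖z - x‖ ^ 2 ≤ τ ^ 2 + 2 * ‖x - q‖ ^ 2 := by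
  have hfed := two_mul_abs_inner_le_of_isNearestPt hA hτ₀ hτ hlin hq hx
  rw [hzq] at hfed
  have hinner : 2 * |⟪z - q, x - q⟫| ≤ ‖x - q‖ ^ 2 := by
    refine le_of_mul_le_mul_left ?_ hτ₀
    linarith
  rw [← sub_sub_sub_cancel_right z x q, norm_sub_sq_real (z - q), hzq]
  linarith [neg_abs_le ⟪z - q, x - q⟫]

/-- Moving from `x` along the unit tangent vector towards `z` would bring a point of `A` closer
than `τ` to `z` if the tangential component `P` of `z - x` were large. Steps of length `P / 3` make
the best use of `infDist_add_smul_le`: they give `P ^ 2 ≤ 6 * ‖x - q‖ ^ 2`, and `√6 < 49 / 20`. -/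
theorem norm_starProjection_sub_le [ProperSpace E] (hA : IsClosed A) {τ : ℝ} (hτ₀ : 0 < τ)
    (hτ : HasReachAtLeast A τ) (hlin : HasLinearTangentCones A) {S : Submodule ℝ E}
    [S.HasOrthogonalProjection] {z q x : E} (hq : IsNearestPt A z q) (hzq : ‖z - q‖ = τ)
    (hx : x ∈ A) (hS : (S : Set E) ⊆ posTangentConeAt A x) (hxq : 4 * ‖x - q‖ ≤ τ) :
    ‖S.starProjection (z - x)‖ ≤ 49 / 20 * ‖x - q‖ := by
  set P := ‖S.starProjection (z - x)‖ with hP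
  rcases (norm_nonneg (S.starProjection (z - x))).eq_or_lt with hP₀ | hP₀ <;> rw [← hP] at hP₀
  · rw [← hP₀]
    positivity
  have hzx : ‖z - x‖ ^ 2 ≤ τ ^ 2 + 2 * ‖x - q‖ ^ 2 :=
    norm_sub_sq_le_of_isNearestPt hA hτ₀ hτ hlin hq hzq hx
  have hPτ : P ≤ 6 / 5 * τ := by
    refine (S.norm_starProjection_apply_le _).trans (le_of_sq_le_sq ?_ (by positivity))
    nlinarith [norm_nonneg (x - q)]
  set u := P⁻¹ • S.starProjection (z - x) with hu
  have hu₁ : ‖u‖ = 1 := by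
    rw [hu, norm_smul, Real.norm_of_nonneg (inv_nonneg.2 hP₀.le), inv_mul_cancel₀ hP₀.ne']
  have huS : u ∈ S := S.smul_mem _ (S.starProjection_apply_mem _)
  have huz : ⟪z - x, u⟫ = P := by
    have hself : ⟪S.starProjection (z - x), z - x⟫ = P ^ 2 :=
      S.re_inner_starProjection_eq_normSq (z - x)
    rw [hu, real_inner_smul_right, real_inner_comm, hself, pow_two, inv_mul_cancel_left₀ hP₀.ne']
  have hfar : τ - P ^ 2 / (9 * τ) ≤ ‖z - x - (P / 3) • u‖ := by
    have hclose := infDist_add_smul_le hA hτ₀ hτ hlin hx (hS huS) hu₁ (L := P / 3)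
      (by linarith) (by linarith)
    have htri := infDist_le_infDist_add_dist (s := A) (x := z) (y := x + (P / 3) • u)
    rw [← hq.2, dist_eq_norm, hzq, dist_eq_norm, ← sub_sub] at htri
    have : (P / 3) ^ 2 / τ = P ^ 2 / (9 * τ) := by field_simp; norm_num
    linarith
  have hsmall : P ^ 2 / (9 * τ) ≤ τ := by
    rw [div_le_iff₀ (by positivity)]
    nlinarith
  have hnorm : ‖z - x - (P / 3) • u‖ ^ 2 = ‖z - x‖ ^ 2 - 5 / 9 * P ^ 2 := by
    rw [norm_sub_sq_real (z - x), real_inner_smul_right, huz, norm_smul, hu₁, mul_one,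
      Real.norm_of_nonneg (by positivity)]
    ring
  have hsq := pow_le_pow_left₀ (sub_nonneg.2 hsmall) hfar 2
  have hexpand : τ ^ 2 - 2 / 9 * P ^ 2 ≤ (τ - P ^ 2 / (9 * τ)) ^ 2 := by
    have : τ * (P ^ 2 / (9 * τ)) = P ^ 2 / 9 := by field_simp
    nlinarith [sq_nonneg (P ^ 2 / (9 * τ))]
  refine le_of_sq_le_sq ?_ (by positivity)
  nlinarith [sq_nonneg ‖x - q‖]

theorem sub_eq_two_smul_sub_of_norm_le {τ : ℝ} {z q₁ q₂ : E} (h₁ : ‖z - q₁‖ ≤ τ)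
    (h₂ : ‖z - q₂‖ ≤ τ) (h : ‖q₂ - q₁‖ = 2 * τ) : q₂ - q₁ = (2 : ℝ) • (z - q₁) := by
  have hpar := parallelogram_law_with_norm ℝ (z - q₁) (z - q₂)
  rw [sub_sub_sub_cancel_left, h] at hpar
  have hsum : ‖(z - q₁) + (z - q₂)‖ = 0 := by
    nlinarith [norm_nonneg ((z - q₁) + (z - q₂)), norm_nonneg (z - q₁), norm_nonneg (z - q₂)]
  rw [← sub_eq_zero, ← neg_eq_zero, ← norm_eq_zero.1 hsum, two_smul]
  abel

/-- The constant `69 / 10 = 2 * (49 / 20 + 1)` is the one that `norm_starProjection_sub_le` gives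
for `q₂ - q₁ = 2 • ((z - x) + (x - q₁))`. -/
theorem sub_mul_norm_sub_sq_le {S : Submodule ℝ E} [S.HasOrthogonalProjection]
    {q₁ q₂ x y : E} {τ m : ℝ} (hτ : 0 < τ) (hm : 4 * m ≤ τ) (hq : ‖q₂ - q₁‖ = 2 * τ)
    (hx : ‖x - q₁‖ ≤ m) (hy : ‖y - q₂‖ ≤ m) (hS : ‖S.starProjection (q₂ - q₁)‖ ≤ 69 / 10 * m) :
    (τ - 4 * m) * ‖y - x‖ ^ 2 ≤ 2 * τ ^ 2 * ‖Sᗮ.starProjection (y - x)‖ := by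
  have hm₀ : 0 ≤ m := (norm_nonneg _).trans hx
  have hsub : y - x = (q₂ - q₁) + ((y - q₂) - (x - q₁)) := by abel
  have herr : ‖(y - q₂) - (x - q₁)‖ ≤ 2 * m := (norm_sub_le _ _).trans (by linarith)
  have hlength : ‖y - x‖ ≤ 2 * τ + 2 * m := by
    rw [hsub]
    exact (norm_add_le _ _).trans (by linarith)
  set b := ‖Sᗮ.starProjection (q₂ - q₁)‖
  have hb : b ≤ 2 * τ := by
    rw [← hq]
    exact Sᗮ.norm_starProjection_apply_le _
  have hb_lower : 4 * τ ^ 2 - (69 / 10 * m) ^ 2 ≤ 2 * τ * b := by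
    have hpyth : (2 * τ) ^ 2 = ‖S.starProjection (q₂ - q₁)‖ ^ 2 + b ^ 2 := by
      rw [← hq]
      exact Submodule.norm_sq_eq_add_norm_sq_starProjection _ S
    nlinarith [pow_le_pow_left₀ (norm_nonneg _) hS 2, norm_nonneg (Sᗮ.starProjection (q₂ - q₁))]
  have hnormal : b - 2 * m ≤ ‖Sᗮ.starProjection (y - x)‖ := by
    rw [hsub, map_add]
    have := norm_sub_le_norm_add (Sᗮ.starProjection (q₂ - q₁))
      (Sᗮ.starProjection ((y - q₂) - (x - q₁)))
    have := Sᗮ.norm_starProjection_apply_le ((y - q₂) - (x - q₁))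
    linarith
  calc (τ - 4 * m) * ‖y - x‖ ^ 2 ≤ (τ - 4 * m) * (2 * τ + 2 * m) ^ 2 := by
        gcongr
    _ ≤ τ * (4 * τ ^ 2 - (69 / 10 * m) ^ 2) - 4 * τ ^ 2 * m := by
        have : 0 ≤ m * (τ - 4 * m) * τ := by
          have : 0 ≤ τ - 4 * m := by linarith
          positivity
        have : 0 ≤ m * (τ - 4 * m) ^ 2 := by positivity
        have : 0 ≤ m ^ 3 := by positivity
        nlinarith
    _ ≤ τ * (2 * τ * b) - 4 * τ ^ 2 * m := by gcongr
    _ = 2 * τ ^ 2 * (b - 2 * m) := by ring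
    _ ≤ 2 * τ ^ 2 * ‖Sᗮ.starProjection (y - x)‖ := by gcongr

theorem inv_le_of_bottleneck [ProperSpace E] (hA : IsClosed A) {τ : ℝ} (hτ₀ : 0 < τ)
    (hτ : HasReachAtLeast A τ) (hlin : HasLinearTangentCones A) {S : Submodule ℝ E}
    [S.HasOrthogonalProjection] {z q₁ q₂ x y : E} {m : ℝ} (hq₁ : q₁ ∈ A) (hz : τ ≤ infDist z A)
    (hzq₁ : ‖z - q₁‖ ≤ τ) (hzq₂ : ‖z - q₂‖ ≤ τ) (hq : ‖q₂ - q₁‖ = 2 * τ) (hx : x ∈ A)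
    (hS : (S : Set E) ⊆ posTangentConeAt A x) (hxm : ‖x - q₁‖ ≤ m)
    (hym : ‖y - q₂‖ ≤ m) :
    τ⁻¹ ≤ 4 / τ ^ 2 * m + 2 * ‖Sᗮ.starProjection (y - x)‖ / ‖y - x‖ ^ 2 := by
  have hsplit : τ⁻¹ = 4 / τ ^ 2 * m + (τ - 4 * m) / τ ^ 2 := by
    field_simp
    ring
  rw [hsplit]
  refine add_le_add_right ?_ _
  rcases le_or_gt τ (4 * m) with hm | hm
  · exact (div_nonpos_of_nonpos_of_nonneg (by linarith) (by positivity)).trans (by positivity)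
  have hnear : IsNearestPt A z q₁ :=
    isNearestPt_of_dist_le_infDist hq₁ (by rw [dist_eq_norm]; linarith)
  have hzq : ‖z - q₁‖ = τ := by
    refine hzq₁.antisymm ?_
    rwa [← dist_eq_norm, hnear.2]
  have hproj : ‖S.starProjection (q₂ - q₁)‖ ≤ 69 / 10 * m := by
    have hzx := norm_starProjection_sub_le hA hτ₀ hτ hlin hnear hzq hx hS (by linarith)
    have hxq := S.norm_starProjection_apply_le (x - q₁)
    have htri := norm_add_le (S.starProjection (z - x)) (S.starProjection (x - q₁))
    rw [← map_add, sub_add_sub_cancel] at htri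
    rw [sub_eq_two_smul_sub_of_norm_le hzq₁ hzq₂ hq, map_smul, norm_smul, Real.norm_two]
    linarith
  have hpos : 0 < ‖y - x‖ := by
    have hq₁y := norm_sub_le_norm_sub_add_norm_sub q₂ y q₁
    have hxy := norm_sub_le_norm_sub_add_norm_sub y x q₁
    rw [norm_sub_rev q₂ y] at hq₁y
    linarith
  rw [div_le_div_iff₀ (by positivity) (by positivity)]
  linarith [sub_mul_norm_sub_sq_le hτ₀ hm.le hq hxm hym hproj]

end Bottleneck

section OrthogonalProjection

variable {E : Type*} [NormedAddCommGroup E] [InnerProductSpace ℝ E] (S : Submodule ℝ E)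
  [S.HasOrthogonalProjection]

theorem norm_starProjection_orthogonal_le_norm_sub (v : E) {w : E} (hw : w ∈ S) :
    ‖Sᗮ.starProjection v‖ ≤ ‖v - w‖ := by
  have hvw : Sᗮ.starProjection (v - w) = Sᗮ.starProjection v := by
    rw [map_sub, S.starProjection_orthogonal_apply_eq_zero hw, sub_zero]
  rw [← hvw]
  exact Sᗮ.norm_starProjection_apply_le _

theorem infEDist_eq_enorm_starProjection_orthogonal (v : E) :
    infEDist v (S : Set E) = ‖Sᗮ.starProjection v‖ₑ := by
  refine le_antisymm ?_ (le_infEDist.2 fun w hw ↦ ?_)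
  · refine (infEDist_le_edist_of_mem (S.starProjection_apply_mem v)).trans_eq ?_
    rw [S.starProjection_orthogonal_val, edist_eq_enorm_sub]
  · rw [edist_eq_enorm_sub, enorm_le_iff_norm_le]
    exact norm_starProjection_orthogonal_le_norm_sub S v hw

theorem two_mul_mul_norm_starProjection_orthogonal_le [ProperSpace E] {A : Set E}
    (hA : IsClosed A) {τ : ℝ} (hτ₀ : 0 < τ) (hτ : HasReachAtLeast A τ) {x y : E} (hx : x ∈ A)
    (hy : y ∈ A) (hS : posTangentConeAt A x ⊆ S) :
    2 * τ * ‖Sᗮ.starProjection (y - x)‖ ≤ ‖y - x‖ ^ 2 := by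
  set v := Sᗮ.starProjection (y - x)
  rcases (norm_nonneg v).eq_or_lt with hv₀ | hv₀
  · rw [← hv₀, mul_zero]
    positivity
  have hv : v ∈ normalCone A x := fun u hu ↦
    (S.inner_left_of_mem_orthogonal (hS hu) (Sᗮ.starProjection_apply_mem _)).le
  have hself : ⟪v, y - x⟫ = ‖v‖ ^ 2 := Sᗮ.re_inner_starProjection_eq_normSq (y - x)
  have hfed := two_mul_mul_inner_le_of_mem_normalCone hA hτ₀ hτ hx hy hv
  rw [hself] at hfed
  refine le_of_mul_le_mul_left ?_ hv₀
  linarith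

end OrthogonalProjection

section Submanifold

theorem injective_mfderiv_of_isImmersionAt {E E' M : Type*} [NormedAddCommGroup E]
    [NormedSpace ℝ E] [NormedAddCommGroup E'] [NormedSpace ℝ E'] [TopologicalSpace M]
    [ChartedSpace E M] {n : WithTop ℕ∞} [IsManifold 𝓘(ℝ, E) n M] (hn : 1 ≤ n) {f : M → E'} {x : M}
    (h : Manifold.IsImmersionAt 𝓘(ℝ, E) 𝓘(ℝ, E') n f x) :
    Function.Injective (mfderiv 𝓘(ℝ, E) 𝓘(ℝ, E') f x) := by
  have : IsManifold 𝓘(ℝ, E) 1 M := IsManifold.of_le hn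
  have hdom : h.domChart.MDifferentiable 𝓘(ℝ, E) 𝓘(ℝ, E) :=
    have hatlas := IsManifold.maximalAtlas_subset_of_le hn h.domChart_mem_maximalAtlas
    ⟨fun y hy ↦ (mdifferentiableAt_of_mem_maximalAtlas hatlas hy).mdifferentiableWithinAt,
      fun y hy ↦ (mdifferentiableAt_symm_of_mem_maximalAtlas hatlas hy).mdifferentiableWithinAt⟩
  have hcod : MDifferentiableAt 𝓘(ℝ, E') 𝓘(ℝ, E') h.codChart (f x) :=
    mdifferentiableAt_of_mem_maximalAtlas
      (IsManifold.maximalAtlas_subset_of_le hn h.codChart_mem_maximalAtlas) h.mem_codChart_source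
  have hf : MDifferentiableAt 𝓘(ℝ, E) 𝓘(ℝ, E') f x :=
    h.contMDiffAt.mdifferentiableAt (zero_lt_one.trans_le hn).ne'
  let A : E →L[ℝ] E' := (h.equiv : (E × h.complement) →L[ℝ] E').comp
    (ContinuousLinearMap.inl ℝ E h.complement)
  have hA : Function.Injective A :=
    h.equiv.injective.comp (Prod.mk_left_injective (0 : h.complement))
  have hcharts : h.codChart ∘ f =ᶠ[𝓝 x] A ∘ h.domChart := by
    filter_upwards [h.domChart.open_source.mem_nhds h.mem_domChart_source] with y hy
    have hy' : h.domChart y ∈ (h.domChart.extend 𝓘(ℝ, E)).target := by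
      simpa using h.domChart.map_source hy
    simpa [hy, A] using h.writtenInCharts hy'
  have hderiv := hcharts.mfderiv_eq (I := 𝓘(ℝ, E)) (I' := 𝓘(ℝ, E'))
  rw [mfderiv_comp x hcod hf, mfderiv_comp x A.mdifferentiableAt
    (hdom.mdifferentiableAt h.mem_domChart_source), A.mfderiv_eq] at hderiv
  have hcomp := hA.comp (hdom.mfderiv_injective h.mem_domChart_source)
  exact fun v w hvw ↦ hcomp <| (DFunLike.congr_fun hderiv v).symm.trans <|
    (congrArg (mfderiv 𝓘(ℝ, E') 𝓘(ℝ, E') h.codChart (f x)) hvw).trans (DFunLike.congr_fun hderiv w)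

theorem hasFDerivAt_comp_chartAt_symm {E E' M : Type*} [NormedAddCommGroup E]
    [NormedSpace ℝ E] [NormedAddCommGroup E'] [NormedSpace ℝ E'] [TopologicalSpace M]
    [ChartedSpace E M] {f : M → E'} {q : M} (hf : MDifferentiableAt 𝓘(ℝ, E) 𝓘(ℝ, E') f q) :
    HasFDerivAt (f ∘ (chartAt E q).symm) (mfderiv 𝓘(ℝ, E) 𝓘(ℝ, E') f q : E →L[ℝ] E')
      (chartAt E q q) := by
  have hwritten := hf.hasMFDerivAt.2
  rw [modelWithCornersSelf_coe, range_id] at hwritten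
  exact hasFDerivWithinAt_univ.1 hwritten

theorem map_val_comp_chartAt_symm_nhds {H X : Type*} [TopologicalSpace H] [TopologicalSpace X]
    {M : Set X} [ChartedSpace H M] (q : M) :
    map (Subtype.val ∘ (chartAt H q).symm) (𝓝 (chartAt H q q)) = 𝓝[M] (q : X) := by
  rw [← map_map, (chartAt H q).symm_map_nhds_eq (mem_chart_source H q), map_nhds_subtype_val]

section Parametrization

variable {E F : Type*} [NormedAddCommGroup E] [NormedSpace ℝ E] [NormedAddCommGroup F]
  [NormedSpace ℝ F] {A : Set E} {f : F → E} {f' : F →L[ℝ] E} {u : F}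

theorem range_subset_posTangentConeAt (hf : HasFDerivAt f f' u)
    (hfA : ∀ᶠ a in 𝓝 u, f a ∈ A) : range f' ⊆ posTangentConeAt A (f u) := by
  rintro _ ⟨a, rfl⟩
  have hline : Tendsto (fun s : ℝ ↦ u + s • a) (𝓝[>] 0) (𝓝 u) := by
    have : Tendsto (fun s : ℝ ↦ u + s • a) (𝓝 0) (𝓝 (u + (0 : ℝ) • a)) :=
      Continuous.tendsto (by fun_prop) 0
    simpa using this.mono_left nhdsWithin_le_nhds
  exact mem_posTangentConeAt_of_tendsto le_rfl (hline.eventually hfA)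
    (hf.hasLineDerivAt a).tendsto_slope_zero_right

theorem hasFDerivWithinAt_zero_of_map_nhds_eq {G : Type*} [NormedAddCommGroup G]
    [NormedSpace ℝ G] (hf : HasFDerivAt f f' u) (hf' : IsInducing f')
    (hmap : map f (𝓝 u) = 𝓝[A] (f u)) {L : E →L[ℝ] G} (hL : L ∘L f' = 0) :
    HasFDerivWithinAt L (0 : E →L[ℝ] G) A (f u) := by
  rw [hasFDerivWithinAt_iff_isLittleO, ← hmap, Asymptotics.isLittleO_map]
  refine Asymptotics.IsLittleO.trans_isBigO ?_ (hf.isTheta_sub hf').isBigO_symm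
  have := (L.hasFDerivAt.comp u hf).isLittleO
  simpa [Function.comp_def, hL] using this

theorem posTangentConeAt_subset_range [FiniteDimensional ℝ F] (hf : HasFDerivAt f f' u)
    (hf' : Function.Injective f') (hmap : map f (𝓝 u) = 𝓝[A] (f u)) :
    posTangentConeAt A (f u) ⊆ range f' := by
  have : IsClosed (f'.range : Set E) := Submodule.closed_of_finiteDimensional _
  have hL : f'.range.mkQL ∘L f' = 0 := by
    ext a
    exact (Submodule.Quotient.mk_eq_zero _).2 ⟨a, rfl⟩
  have hind : IsInducing f' :=
    (LinearMap.isClosedEmbedding_of_injective (LinearMap.ker_eq_bot.2 hf')).isInducing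
  intro y hy
  have hzero := f'.range.mkQL.hasFDerivWithinAt.unique_on
    (hasFDerivWithinAt_zero_of_map_nhds_eq hf hind hmap hL) (tangentConeAt_mono_field hy)
  exact (Submodule.Quotient.mk_eq_zero f'.range).1 hzero

end Parametrization

theorem posTangentConeAt_eq_tangent {d D : ℕ} {n : WithTop ℕ∞} (hn : 1 ≤ n)
    {M : Set (EuclideanSpace ℝ (Fin D))} [ChartedSpace (EuclideanSpace ℝ (Fin d)) M]
    [IsManifold (𝓡 d) n M] (hM : Manifold.IsSmoothEmbedding (𝓡 d)
      𝓘(ℝ, EuclideanSpace ℝ (Fin D)) n (Subtype.val : M → EuclideanSpace ℝ (Fin D))) (q : M) :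
    posTangentConeAt M (q : EuclideanSpace ℝ (Fin D)) = tangent d M q := by
  have hderiv := hasFDerivAt_comp_chartAt_symm
    ((hM.contMDiff q).mdifferentiableAt (zero_lt_one.trans_le hn).ne')
  have hinj := injective_mfderiv_of_isImmersionAt hn (hM.isImmersion.isImmersionAt q)
  have hq : (Subtype.val ∘ (chartAt (EuclideanSpace ℝ (Fin d)) q).symm)
      (chartAt (EuclideanSpace ℝ (Fin d)) q q) = (q : EuclideanSpace ℝ (Fin D)) := by simp
  have hmap := map_val_comp_chartAt_symm_nhds (H := EuclideanSpace ℝ (Fin d)) q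
  rw [← hq] at hmap ⊢
  exact (posTangentConeAt_subset_range hderiv hinj hmap).antisymm
    (range_subset_posTangentConeAt hderiv (mem_map.1 (hmap ▸ self_mem_nhdsWithin)))

theorem hasLinearTangentCones_of_isSmoothEmbedding {d D : ℕ} {n : WithTop ℕ∞} (hn : 1 ≤ n)
    {M : Set (EuclideanSpace ℝ (Fin D))} [ChartedSpace (EuclideanSpace ℝ (Fin d)) M]
    [IsManifold (𝓡 d) n M] (hM : Manifold.IsSmoothEmbedding (𝓡 d)
      𝓘(ℝ, EuclideanSpace ℝ (Fin D)) n (Subtype.val : M → EuclideanSpace ℝ (Fin D))) :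
    HasLinearTangentCones M :=
  fun p hp ↦ ⟨tangent d M ⟨p, hp⟩, posTangentConeAt_eq_tangent hn hM ⟨p, hp⟩⟩

end Submanifold

section PlugInEstimator

variable {D : ℕ} {M : Set (EuclideanSpace ℝ (Fin D))}

theorem hasReachAtLeast_reach : HasReachAtLeast M (reach M).toReal := by
  intro w hw p q hp hq
  by_contra hne
  have hmedial : w ∈ medialAxis M :=
    ⟨p, hp.1, q, hq.1, hne, dist_comm p w ▸ hp.2, dist_comm q w ▸ hq.2⟩
  exact hw.not_ge (ENNReal.toReal_mono (infEDist_ne_top ⟨p, hp.1⟩) (iInf₂_le w hmedial))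

theorem IsBottleneck.reach_pos {q₁ q₂ : M} (hq : IsBottleneck M q₁ q₂) : 0 < reach M := by
  refine pos_iff_ne_zero.2 fun h ↦ hq.1.1 (edist_eq_zero.1 ?_)
  rw [hq.2, h, mul_zero]

theorem IsBottleneck.reach_ne_top {q₁ q₂ : M} (hq : IsBottleneck M q₁ q₂) : reach M ≠ ⊤ := by
  obtain ⟨⟨-, z, hz, -⟩, -⟩ := hq
  exact ne_top_of_le_ne_top (infEDist_ne_top ⟨_, q₁.2⟩) (iInf₂_le z hz)

theorem edist_le_geodesicEDist (p q : M) : edist p q ≤ geodesicEDist M p q := by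
  refine le_iInf₂ fun γ hγ ↦ le_iInf₂ fun _ hp ↦ le_iInf fun hq ↦ ?_
  rw [Subtype.edist_eq, ← hp, ← hq, edist_comm, edist_eq_enorm_sub]
  exact enorm_sub_le_lintegral_derivWithin_Icc_of_contDiffOn_Icc hγ zero_le_one

section TauHat

variable {d : ℕ} [ChartedSpace (EuclideanSpace ℝ (Fin d)) M]

theorem tauHat_anti {X Y : Set M} (h : X ⊆ Y) : tauHat d M Y ≤ tauHat d M X :=
  le_iInf₂ fun x hx ↦ le_iInf₂ fun y hy ↦ (iInf₂_le x (h hx)).trans (iInf₂_le y (h hy))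

theorem enorm_sq_div_two_mul_infEDist_tangent (x : M) (v : EuclideanSpace ℝ (Fin D)) :
    ‖v‖ₑ ^ 2 / (2 * infEDist v (tangent d M x : Set (EuclideanSpace ℝ (Fin D)))) =
      ENNReal.ofReal (‖v‖ ^ 2) / ENNReal.ofReal (2 * ‖(tangent d M x)ᗮ.starProjection v‖) := by
  rw [infEDist_eq_enorm_starProjection_orthogonal, ENNReal.ofReal_pow (norm_nonneg _),
    ENNReal.ofReal_mul zero_le_two, ofReal_norm, ofReal_norm, ENNReal.ofReal_ofNat]

theorem ofReal_le_inv_tauHat_pair (x y : M) :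
    ENNReal.ofReal (2 * ‖(tangent d M x)ᗮ.starProjection
      ((y : EuclideanSpace ℝ (Fin D)) - x)‖ / ‖(y : EuclideanSpace ℝ (Fin D)) - x‖ ^ 2) ≤
      (tauHat d M {x, y})⁻¹ := by
  rcases eq_or_ne x y with rfl | hxy
  · simp
  have hpos : 0 < ‖(y : EuclideanSpace ℝ (Fin D)) - x‖ ^ 2 :=
    pow_pos (norm_pos_iff.2 (sub_ne_zero.2 fun h ↦ hxy (Subtype.ext h.symm))) 2
  rw [ENNReal.ofReal_div_of_pos hpos, ← ENNReal.inv_div (Or.inl ENNReal.ofReal_ne_top)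
    (Or.inr (ENNReal.ofReal_pos.2 hpos).ne'), ← enorm_sq_div_two_mul_infEDist_tangent]
  exact ENNReal.inv_le_inv.2
    ((iInf₂_le x (by simp)).trans ((iInf₂_le y (by simp)).trans (iInf_le _ hxy)))

variable {n : WithTop ℕ∞} [IsManifold (𝓡 d) n M]

theorem ofReal_le_tauHat (hn : 1 ≤ n) (hM : Manifold.IsSmoothEmbedding (𝓡 d)
      𝓘(ℝ, EuclideanSpace ℝ (Fin D)) n (Subtype.val : M → EuclideanSpace ℝ (Fin D)))
    (hMclosed : IsClosed M) {τ : ℝ} (hτ₀ : 0 < τ) (hτ : HasReachAtLeast M τ) (X : Set M) :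
    ENNReal.ofReal τ ≤ tauHat d M X := by
  refine le_iInf₂ fun x _ ↦ le_iInf₂ fun y _ ↦ le_iInf fun hxy ↦ ?_
  have hpos : 0 < ‖(y : EuclideanSpace ℝ (Fin D)) - x‖ ^ 2 :=
    pow_pos (norm_pos_iff.2 (sub_ne_zero.2 fun h ↦ hxy (Subtype.ext h.symm))) 2
  rw [enorm_sq_div_two_mul_infEDist_tangent, ENNReal.le_div_iff_mul_le
    (Or.inr (ENNReal.ofReal_pos.2 hpos).ne') (Or.inl ENNReal.ofReal_ne_top),
    ← ENNReal.ofReal_mul hτ₀.le, ← mul_assoc, mul_comm τ]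
  exact ENNReal.ofReal_le_ofReal (two_mul_mul_norm_starProjection_orthogonal_le _ hMclosed hτ₀ hτ
    x.2 y.2 (posTangentConeAt_eq_tangent hn hM x).subset)

theorem IsBottleneck.inv_reach_le (hn : 1 ≤ n) (hM : Manifold.IsSmoothEmbedding (𝓡 d)
      𝓘(ℝ, EuclideanSpace ℝ (Fin D)) n (Subtype.val : M → EuclideanSpace ℝ (Fin D)))
    (hMclosed : IsClosed M) {q₁ q₂ : M} (hq : IsBottleneck M q₁ q₂) (x y : M) :
    (reach M)⁻¹ ≤ 4 / reach M ^ 2 * max (edist q₁ x) (edist q₂ y) + (tauHat d M {x, y})⁻¹ := by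
  set τ := (reach M).toReal
  set m := max (dist q₁ x) (dist q₂ y)
  have hτ₀ : 0 < τ := ENNReal.toReal_pos hq.reach_pos.ne' hq.reach_ne_top
  have hreach : reach M = ENNReal.ofReal τ := (ENNReal.ofReal_toReal hq.reach_ne_top).symm
  have hm : max (edist q₁ x) (edist q₂ y) = ENNReal.ofReal m := by
    rw [edist_dist, edist_dist, ENNReal.ofReal_max]
  obtain ⟨⟨-, z, hz, hzq₁, hzq₂⟩, hq₁₂⟩ := hq
  have hzτ : τ ≤ infDist z M := ENNReal.toReal_mono (infEDist_ne_top ⟨_, q₁.2⟩) (iInf₂_le z hz)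
  rw [hreach, edist_comm, edist_dist, ENNReal.ofReal_le_ofReal_iff hτ₀.le, dist_eq_norm]
    at hzq₁ hzq₂
  have hsize : ‖(q₂ : EuclideanSpace ℝ (Fin D)) - q₁‖ = 2 * τ := by
    rw [← dist_eq_norm', ← Subtype.dist_eq, dist_edist, hq₁₂, ENNReal.toReal_mul,
      ENNReal.toReal_ofNat]
  have hle := inv_le_of_bottleneck hMclosed hτ₀ hasReachAtLeast_reach
    (hasLinearTangentCones_of_isSmoothEmbedding hn hM) q₁.2 hzτ hzq₁ hzq₂ hsize x.2
    (posTangentConeAt_eq_tangent hn hM x).superset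
    ((dist_eq_norm' _ _).symm.trans_le (le_max_left (dist q₁ x) (dist q₂ y)))
    ((dist_eq_norm' _ _).symm.trans_le (le_max_right (dist q₁ x) (dist q₂ y)))
  have hcoe : 4 / reach M ^ 2 * max (edist q₁ x) (edist q₂ y) =
      ENNReal.ofReal (4 / τ ^ 2 * m) := by
    rw [hm, hreach, ENNReal.ofReal_mul (by positivity), ENNReal.ofReal_div_of_pos (by positivity),
      ENNReal.ofReal_pow hτ₀.le, ENNReal.ofReal_ofNat]
  rw [hcoe, hreach, ← ENNReal.ofReal_inv_of_pos hτ₀]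
  refine (ENNReal.ofReal_le_ofReal hle).trans ?_
  rw [ENNReal.ofReal_add (by positivity) (by positivity)]
  exact add_le_add_right (ofReal_le_inv_tauHat_pair x y) _

end TauHat

theorem recip_le_recip {a b : ℝ≥0∞} (h : a ≤ b) : recip b ≤ recip a :=
  EReal.coe_ennreal_le_coe_ennreal_iff.2 (ENNReal.inv_le_inv.2 h)

theorem recip_sub_recip_nonneg {a b : ℝ≥0∞} (ha : a ≠ 0) (h : a ≤ b) :
    0 ≤ recip a - recip b := by
  have htop : recip a ≠ ⊤ := by simpa [recip] using ha
  have hbot : recip a ≠ ⊥ := by simp [recip]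
  exact (EReal.sub_nonneg (Or.inl htop) (Or.inl hbot)).2 (recip_le_recip h)

theorem recip_sub_recip_le {a b c : ℝ≥0∞} (h : a⁻¹ ≤ c + b⁻¹) : recip a - recip b ≤ c := by
  refine EReal.sub_le_of_le_add ?_
  rw [recip, recip, ← EReal.coe_ennreal_add]
  exact EReal.coe_ennreal_le_coe_ennreal_iff.2 h

end PlugInEstimator

end Reach

theorem mainTheorem3_general {d D : ℕ} {n : WithTop ℕ∞} (hn : 1 ≤ n)
    (M : Set (EuclideanSpace ℝ (Fin D)))
    [ChartedSpace (EuclideanSpace ℝ (Fin d)) M] [IsManifold (𝓡 d) n M]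
    (hM : Manifold.IsSmoothEmbedding (𝓡 d) 𝓘(ℝ, EuclideanSpace ℝ (Fin D)) n
      (Subtype.val : M → EuclideanSpace ℝ (Fin D)))
    (hMclosed : IsClosed M)
    (q₁ q₂ : M) (hq : Reach.IsBottleneck M q₁ q₂)
    (X : Set M) (x y : M) (hx : x ∈ X) (hy : y ∈ X) :
    0 ≤ Reach.recip (Reach.reach M) - Reach.recip (Reach.tauHat d M X) ∧
    Reach.recip (Reach.reach M) - Reach.recip (Reach.tauHat d M X) ≤
      Reach.recip (Reach.reach M) - Reach.recip (Reach.tauHat d M {x, y}) ∧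
    Reach.recip (Reach.reach M) - Reach.recip (Reach.tauHat d M {x, y}) ≤
      ((4 / Reach.reach M ^ 2 * max (edist q₁ x) (edist q₂ y) : ℝ≥0∞) : EReal) := by
  have hreach : Reach.reach M ≤ Reach.tauHat d M X := by
    rw [← ENNReal.ofReal_toReal hq.reach_ne_top]
    exact Reach.ofReal_le_tauHat hn hM hMclosed
      (ENNReal.toReal_pos hq.reach_pos.ne' hq.reach_ne_top) Reach.hasReachAtLeast_reach X
  have hanti : Reach.tauHat d M X ≤ Reach.tauHat d M {x, y} :=
    Reach.tauHat_anti (pair_subset hx hy)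
  exact ⟨Reach.recip_sub_recip_nonneg hq.reach_pos.ne' hreach,
    EReal.sub_le_sub le_rfl (Reach.recip_le_recip hanti),
    Reach.recip_sub_recip_le (hq.inv_reach_le hn hM hMclosed x y)⟩

theorem mainTheorem3 {d D : ℕ} (hd : 1 ≤ d) (hdD : d < D) {n : WithTop ℕ∞} (hn : 1 ≤ n)
    (M : Set (EuclideanSpace ℝ (Fin D)))
    [ChartedSpace (EuclideanSpace ℝ (Fin d)) M] [IsManifold (𝓡 d) n M]
    (hM : Manifold.IsSmoothEmbedding (𝓡 d) 𝓘(ℝ, EuclideanSpace ℝ (Fin D)) n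
      (Subtype.val : M → EuclideanSpace ℝ (Fin D)))
    (hMcompact : IsCompact M) (hMconn : IsConnected M)
    (hreach : 0 < Reach.reach M)
    (q₁ q₂ : M) (hq : Reach.IsBottleneck M q₁ q₂)
    (X : Set M) (x y : M) (hx : x ∈ X) (hy : y ∈ X)
    (hq₁x : edist q₁ x < Reach.reach M) (hq₂y : edist q₂ y < Reach.reach M) :
    0 ≤ Reach.recip (Reach.reach M) - Reach.recip (Reach.tauHat d M X) ∧
    Reach.recip (Reach.reach M) - Reach.recip (Reach.tauHat d M X) ≤
      Reach.recip (Reach.reach M) - Reach.recip (Reach.tauHat d M {x, y}) ∧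
    Reach.recip (Reach.reach M) - Reach.recip (Reach.tauHat d M {x, y}) ≤
      ((4 / Reach.reach M ^ 2 *
        max (Reach.geodesicEDist M q₁ x) (Reach.geodesicEDist M q₂ y) : ℝ≥0∞) : EReal) := by
  obtain ⟨hnonneg, hmono, hle⟩ :=
    mainTheorem3_general hn M hM hMcompact.isClosed q₁ q₂ hq X x y hx hy
  refine ⟨hnonneg, hmono, hle.trans (EReal.coe_ennreal_le_coe_ennreal_iff.2 ?_)⟩
  gcongr <;> exact Reach.edist_le_geodesicEDist _ _
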